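/- All spaces are finite. A pseudometric on a set $X$ is a map $d:X\times X\to\mathbb R$ with $d(x,x)=0$, $d(x,y)=d(y,x)\ge 0$ and $d(x,z)\le d(x,y)+d(y,z)$; it is a metric if $d(x,y)>0$ for $x\ne y$. Two pseudometric spaces are isometric if there is a bijection between them carrying one pseudometric to the other. **Trim core.** Let $(X,d)$ be a finite pseudometric space. Define $\underline d:X\to\mathbb R$ as follows: if $X$ has one point, $\underline d=0$; if $X=\{x,y\}$ has two points, $\underline d(x)=\underline d(y)=d(x,y)/2$; if $X$ has at least three points, $$\underline d(x)=\inf\left\{\tfrac12\bigl(d(x,y)+d(x,z)-d(y,z)\bigr) : y,z\in X\setminus\{x\},\ y\ne z\right\}.$$ Call $(X,d)$ *trim* if $\underline d=0$. Put $d^\bullet(x,x)=0$ and $d^\bullet(x,y)=d(x,y)-\underline d(x)-\underline d(y)$ for $x\neq y$; this is a pseudometric on $X$. Let $t(X)$ be the metric space obtained from $(X,d^\bullet)$ by identifying points at $d^\bullet$-distance $0$. There is an integer $n\ge 0$ such that $t^n(X)$ (where $t^0(X)=X$) is a trim metric space; for the least such $n$, the space $c(X)=t^n(X)$ is called the *trim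 core* of $X$. Two finite pseudometric spaces are *trim equivalent* if their trim cores are isometric. **Metric forests.** A finite rooted tree $\tau$ is a finite connected graph without cycles, having at least one edge, with a distinguished vertex $\ast$ (the root) and with a length $\ge 0$ assigned to each edge. For vertices $x,y$ let $d_\tau(x,y)$ be the sum of the lengths of the edges of the path in $\tau$ from $x$ to $y$. A leaf of $\tau$ is a vertex of degree $1$ distinct from $\ast$. A finite metric forest $\zeta$ consists of a finite metric space $(B,d_B)$, its *base*, and a finite rooted tree $(\zeta_a,\ast_a)$ for each $a\in B$. Its *leaf space* is the disjoint union over $a\in B$ of the sets of leaves of $\zeta_a$, with the pseudometric given, for a leaf $x$ of $\zeta_a$ and a leaf $y$ of $\zeta_b$, by $$d_\zeta(x,y)=\begin{cases} d_{\zeta_a}(x,y) & \text{if } a=b,\\ d_{\zeta_a}(x,\ast_a)+d_B(a,b)+d_{\zeta_b}(y,\ast_b) & \text{if } a\ne b.\end{cases}$$ **Theorem.** The leaf space and the base of any finite metric forest are trim equivalent to each other. -/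

import Mathlib

universe u v

namespace TrimCore

/-! ### Finite pseudometric spaces -/

/-- A finite pseudometric space. -/
structure FinPMet : Type (u + 1) where
  carrier : Type u
  [finite : Finite carrier]
  [pseudoMetric : PseudoMetricSpace carrier]

instance : CoeSort FinPMet.{u} (Type u) := ⟨FinPMet.carrier⟩

instance (X : FinPMet.{u}) : Finite X := X.finite

instance (X : FinPMet.{u}) : PseudoMetricSpace X := X.pseudoMetric

section Under

variable {X : Type u} [PseudoMetricSpace X]

/-- `d(x, y, z) = (d(x, y) + d(x, z) - d(y, z)) / 2`. -/
noncomputable def triple (x y z : X) : ℝ :=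
  (dist x y + dist x z - dist y z) / 2

/-- The function usually written `d` with an underline, on a finite pseudometric space.
It is `0` on a one-point space and half of the distance to the other point on a two-point space;
with at least three points it is the infimum of `d(x, y, z)` over all pairs of distinct points
`y, z` of the space that are different from `x`. -/
noncomputable def under (x : X) : ℝ :=
  if Nat.card X ≤ 1 then 0
  else if Nat.card X = 2 then (⨅ y : {y : X // y ≠ x}, dist x y.1) / 2
  else ⨅ p : {p : X × X // p.1 ≠ x ∧ p.2 ≠ x ∧ p.1 ≠ p.2}, triple x p.1.1 p.1.2

theorem under_of_card_le_one (h : Nat.card X ≤ 1) (x : X) : under x = 0 := if_pos h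

theorem under_of_card_eq_two [Finite X] (h : Nat.card X = 2) {x y : X} (hxy : y ≠ x) :
    under x = dist x y / 2 := by
  unfold under
  rw [if_neg (by omega), if_pos h]
  congr 1
  have hu : ∀ z : {y : X // y ≠ x}, dist x z.1 = dist x y := by
    rintro ⟨z, hz⟩
    have : z = y := by
      by_contra hzy
      have h3 : ({x, y, z} : Set X).ncard = 3 :=
        Set.ncard_eq_three.2 ⟨x, y, z, hxy.symm, fun e => hz e.symm, fun e => hzy e.symm, rfl⟩
      have := Set.ncard_le_card ({x, y, z} : Set X)
      omega
    subst this; rfl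
  have : Nonempty {y : X // y ≠ x} := ⟨⟨y, hxy⟩⟩
  simp_rw [hu]
  exact ciInf_const

theorem under_of_three_le_card (h : 3 ≤ Nat.card X) (x : X) :
    under x = ⨅ p : {p : X × X // p.1 ≠ x ∧ p.2 ≠ x ∧ p.1 ≠ p.2}, triple x p.1.1 p.1.2 := by
  unfold under
  rw [if_neg (by omega), if_neg (by omega)]

theorem under_le [Finite X] (h : 3 ≤ Nat.card X) {x y z : X} (hy : y ≠ x) (hz : z ≠ x) (hyz : y ≠ z) :
    under x ≤ triple x y z := by
  rw [under_of_three_le_card h]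
  exact ciInf_le (Set.finite_range _).bddBelow
    (⟨(y, z), hy, hz, hyz⟩ : {p : X × X // p.1 ≠ x ∧ p.2 ≠ x ∧ p.1 ≠ p.2})

theorem exists_third [Finite X] (h : 3 ≤ Nat.card X) (x y : X) : ∃ z : X, z ≠ x ∧ z ≠ y := by
  by_contra! hc
  have hs : (Set.univ : Set X) ⊆ {x, y} := by
    intro z _
    by_cases hz : z = x
    · exact Or.inl hz
    · exact Or.inr (hc z hz)
  have h1 := Set.ncard_le_ncard hs
  have h2 : ({x, y} : Set X).ncard ≤ 2 := by
    have := Set.ncard_insert_le x {y}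
    rwa [Set.ncard_singleton] at this
  rw [Set.ncard_univ] at h1
  omega

theorem exists_under_eq [Finite X] (h : 3 ≤ Nat.card X) (x : X) :
    ∃ y z : X, y ≠ x ∧ z ≠ x ∧ y ≠ z ∧ under x = triple x y z := by
  obtain ⟨y, hy, -⟩ := exists_third h x x
  obtain ⟨z, hz, hzy⟩ := exists_third h x y
  have : Nonempty {p : X × X // p.1 ≠ x ∧ p.2 ≠ x ∧ p.1 ≠ p.2} := ⟨⟨(y, z), hy, hz, hzy.symm⟩⟩
  obtain ⟨⟨p, h1, h2, h3⟩, hp⟩ := exists_eq_ciInf_of_finite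
    (f := fun p : {p : X × X // p.1 ≠ x ∧ p.2 ≠ x ∧ p.1 ≠ p.2} => triple x p.1.1 p.1.2)
  exact ⟨p.1, p.2, h1, h2, h3, by rw [under_of_three_le_card h, ← hp]⟩

theorem under_add_under_le [Finite X] {x y : X} (hxy : x ≠ y) : under x + under y ≤ dist x y := by
  rcases Nat.lt_or_ge (Nat.card X) 2 with h | h
  · have := Finite.card_le_one_iff_subsingleton.1 (Nat.le_of_lt_succ h)
    exact absurd (Subsingleton.elim x y) hxy
  rcases Nat.lt_or_ge (Nat.card X) 3 with h3 | h3
  · have h2 : Nat.card X = 2 := by omega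
    rw [under_of_card_eq_two h2 hxy.symm, under_of_card_eq_two h2 hxy, dist_comm y x]
    linarith
  · obtain ⟨z, hzx, hzy⟩ := exists_third h3 x y
    have h1 := under_le h3 hxy.symm hzx hzy.symm
    have h2 := under_le h3 hxy hzy hzx.symm
    unfold triple at h1 h2
    rw [dist_comm y x] at h2
    linarith

/-- The distance `d(x, y) - under x - under y` for `x ≠ y`, and `0` for `x = y`. -/
noncomputable def bulletDist (x y : X) : ℝ :=
  open Classical in if x = y then 0 else dist x y - under x - under y

theorem bulletDist_self (x : X) : bulletDist x x = 0 := by simp [bulletDist]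

theorem bulletDist_of_ne {x y : X} (h : x ≠ y) :
    bulletDist x y = dist x y - under x - under y := by simp [bulletDist, h]

theorem bulletDist_nonneg [Finite X] (x y : X) : 0 ≤ bulletDist x y := by
  by_cases h : x = y
  · rw [h, bulletDist_self]
  · rw [bulletDist_of_ne h]; linarith [under_add_under_le h]

theorem bulletDist_comm (x y : X) : bulletDist x y = bulletDist y x := by
  by_cases h : x = y
  · rw [h]
  · rw [bulletDist_of_ne h, bulletDist_of_ne (Ne.symm h), dist_comm]; ring

theorem bulletDist_triangle [Finite X] (x y z : X) :
    bulletDist x z ≤ bulletDist x y + bulletDist y z := by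
  by_cases hxy : x = y
  · subst hxy; simp [bulletDist_self]
  by_cases hyz : y = z
  · subst hyz; simp [bulletDist_self]
  by_cases hxz : x = z
  · subst hxz; rw [bulletDist_self]; linarith [bulletDist_nonneg x y, bulletDist_nonneg y x]
  have h3 : 3 ≤ Nat.card X := by
    have e : ({x, y, z} : Set X).ncard = 3 := Set.ncard_eq_three.2 ⟨x, y, z, hxy, hxz, hyz, rfl⟩
    have := Set.ncard_le_card ({x, y, z} : Set X)
    omega
  have h := under_le h3 hxy (Ne.symm hyz) hxz
  unfold triple at h
  rw [bulletDist_of_ne hxy, bulletDist_of_ne hyz, bulletDist_of_ne hxz]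
  rw [dist_comm y x] at h
  linarith

theorem under_congr {Y : Type v} [PseudoMetricSpace Y] (e : X ≃ᵢ Y) (x : X) :
    under (e x) = under x := by
  have hc : Nat.card Y = Nat.card X := Nat.card_congr e.symm.toEquiv
  have h2 : (⨅ y : {y : X // y ≠ x}, dist x y.1) = ⨅ y : {y : Y // y ≠ e x}, dist (e x) y.1 :=
    Equiv.iInf_congr (e.toEquiv.subtypeEquiv fun a => by simp) fun y => e.dist_eq x y.1
  have h3 : (⨅ p : {p : X × X // p.1 ≠ x ∧ p.2 ≠ x ∧ p.1 ≠ p.2}, triple x p.1.1 p.1.2) =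
      ⨅ p : {p : Y × Y // p.1 ≠ e x ∧ p.2 ≠ e x ∧ p.1 ≠ p.2}, triple (e x) p.1.1 p.1.2 :=
    Equiv.iInf_congr ((e.toEquiv.prodCongr e.toEquiv).subtypeEquiv fun a => by simp) fun p => by
      simp [triple, e.dist_eq]
  unfold under
  rw [hc, h2, h3]

theorem under_eq_zero_of_bulletDist [Finite X] {Y : Type u} [PseudoMetricSpace Y] (f : Y ≃ X)
    (hf : ∀ x y : Y, dist x y = bulletDist (f x) (f y)) (x : Y) : under x = 0 := by
  have : Finite Y := Finite.of_equiv X f.symm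
  have hcard : Nat.card Y = Nat.card X := Nat.card_congr f
  rcases Nat.lt_or_ge (Nat.card Y) 2 with h | h
  · exact under_of_card_le_one (by omega) x
  rcases Nat.lt_or_ge (Nat.card Y) 3 with h3 | h3
  · have h2 : Nat.card Y = 2 := by omega
    have : Nontrivial Y := Finite.one_lt_card_iff_nontrivial.1 (by omega)
    obtain ⟨y, hy⟩ := exists_ne x
    have h2' : Nat.card X = 2 := hcard ▸ h2
    have hne : f y ≠ f x := f.injective.ne hy
    rw [under_of_card_eq_two h2 hy, hf, bulletDist_of_ne hne.symm, under_of_card_eq_two h2' hne,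
      under_of_card_eq_two h2' hne.symm, dist_comm (f y)]
    ring
  · have h3' : 3 ≤ Nat.card X := hcard ▸ h3
    have ht : ∀ y z : Y, y ≠ x → z ≠ x → y ≠ z →
        triple x y z = triple (f x) (f y) (f z) - under (f x) := by
      intro y z hy hz hyz
      unfold triple
      rw [hf, hf, hf, bulletDist_of_ne (f.injective.ne hy.symm),
        bulletDist_of_ne (f.injective.ne hz.symm), bulletDist_of_ne (f.injective.ne hyz)]
      ring
    apply le_antisymm
    · obtain ⟨y, z, hy, hz, hyz, e⟩ := exists_under_eq h3' (f x)
      obtain ⟨y, rfl⟩ := f.surjective y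
      obtain ⟨z, rfl⟩ := f.surjective z
      have hy' : y ≠ x := fun h => hy (h ▸ rfl)
      have hz' : z ≠ x := fun h => hz (h ▸ rfl)
      have hyz' : y ≠ z := fun h => hyz (h ▸ rfl)
      have := under_le h3 hy' hz' hyz'
      rw [ht y z hy' hz' hyz'] at this
      linarith
    · obtain ⟨y, z, hy, hz, hyz, e⟩ := exists_under_eq h3 x
      rw [e, ht y z hy hz hyz]
      have := under_le h3' (f.injective.ne hy) (f.injective.ne hz) (f.injective.ne hyz)
      linarith

end Under

/-! ### Trimming and the trim core -/

/-- A finite pseudometric space is a trim metric space if its distance separates points and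
the function `under` vanishes. -/
def IsTrimMetric (X : FinPMet.{u}) : Prop :=
  (∀ x y : X, dist x y = 0 → x = y) ∧ ∀ x : X, under x = 0

/-- The same set with the pseudometric `bulletDist`. -/
noncomputable def bullet (X : FinPMet.{u}) : FinPMet.{u} where
  carrier := X
  pseudoMetric :=
    { dist := bulletDist
      dist_self := bulletDist_self
      dist_comm := bulletDist_comm
      dist_triangle := bulletDist_triangle }

/-- The metric quotient: points at distance zero are identified. -/
noncomputable def metricQuotient (X : FinPMet.{u}) : FinPMet.{u} where
  carrier := SeparationQuotient X
  finite := Quotient.finite _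

/-- The trimming `t(X)`. -/
noncomputable def trimming (X : FinPMet.{u}) : FinPMet.{u} := metricQuotient (bullet X)

theorem under_bullet (X : FinPMet.{u}) (x : bullet X) : under x = 0 :=
  under_eq_zero_of_bulletDist (X := X) (Y := bullet X) (Equiv.refl _) (fun _ _ => rfl) x

/-- Every finite pseudometric space has finite height. -/
theorem exists_iterate_trimming_isTrimMetric (X : FinPMet.{u}) :
    ∃ n : ℕ, IsTrimMetric (trimming^[n] X) := by
  induction hN : Nat.card X using Nat.strong_induction_on generalizing X with
  | _ N ih =>
    by_cases hinj : Function.Injective (SeparationQuotient.mk : bullet X → _)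
    · refine ⟨1, ?_, ?_⟩
      · intro x y hxy
        exact eq_of_dist_eq_zero (γ := SeparationQuotient (bullet X)) hxy
      · let e : bullet X ≃ᵢ SeparationQuotient (bullet X) :=
          { toEquiv := Equiv.ofBijective _ ⟨hinj, SeparationQuotient.surjective_mk⟩
            isometry_toFun := Isometry.of_dist_eq SeparationQuotient.dist_mk }
        intro x
        have := under_congr e (e.symm x)
        rw [under_bullet] at this
        exact (congrArg under (e.apply_symm_apply x)).symm.trans this
    · have hlt : Nat.card (trimming X) < N := by
        have hle : Nat.card (SeparationQuotient (bullet X)) ≤ Nat.card (bullet X) :=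
          Nat.card_le_card_of_surjective _ SeparationQuotient.surjective_mk
        have hc : Nat.card (bullet X) = N := hN
        refine lt_of_le_of_ne (hc ▸ hle) fun he => hinj ?_
        exact ((Nat.bijective_iff_surjective_and_card _).2
          ⟨SeparationQuotient.surjective_mk, hc.trans he.symm⟩).1
      obtain ⟨n, hn⟩ := ih _ hlt (trimming X) rfl
      exact ⟨n + 1, by rwa [Function.iterate_succ_apply]⟩

/-- The height: the least `n` such that the `n`-fold trimming is a trim metric space. -/
noncomputable def height (X : FinPMet.{u}) : ℕ :=
  open Classical in Nat.find (exists_iterate_trimming_isTrimMetric X)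

/-- The trim core `c(X)`. -/
noncomputable def trimCore (X : FinPMet.{u}) : FinPMet.{u} := trimming^[height X] X

/-- Two finite pseudometric spaces are trim equivalent if their trim cores are isometric. -/
def TrimEquivalent (X : FinPMet.{u}) (Y : FinPMet.{v}) : Prop :=
  Nonempty (trimCore X ≃ᵢ trimCore Y)

/-! ### Rooted trees and metric forests -/

/-- A finite rooted metric tree with at least one edge. Only the values of `length` on edges of
the tree matter. -/
structure MetricTree : Type (u + 1) where
  vertex : Type u
  [finite : Finite vertex]
  graph : SimpleGraph vertex
  isTree : graph.IsTree
  edge_nonempty : graph.edgeSet.Nonempty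
  length : Sym2 vertex → ℝ
  length_nonneg : ∀ e ∈ graph.edgeSet, 0 ≤ length e
  root : vertex

namespace MetricTree

variable (τ : MetricTree.{u})

instance : Finite τ.vertex := τ.finite

/-- The unique path between two vertices. -/
noncomputable def path (x y : τ.vertex) : τ.graph.Walk x y :=
  (τ.isTree.existsUnique_path x y).choose

theorem path_isPath (x y : τ.vertex) : (τ.path x y).IsPath :=
  (τ.isTree.existsUnique_path x y).choose_spec.1

theorem path_unique {x y : τ.vertex} (w : τ.graph.Walk x y) (hw : w.IsPath) : w = τ.path x y :=
  (τ.isTree.existsUnique_path x y).choose_spec.2 w hw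

/-- The path pseudometric: the sum of the lengths of the edges of the path from `x` to `y`. -/
noncomputable def pathDist (x y : τ.vertex) : ℝ := ((τ.path x y).edges.map τ.length).sum

/-- A leaf is a vertex of degree one distinct from the root. -/
def IsLeaf (x : τ.vertex) : Prop := x ≠ τ.root ∧ (τ.graph.neighborSet x).ncard = 1

/-- The set of leaves. -/
def Leaf : Type u := {x : τ.vertex // τ.IsLeaf x}

instance : Finite τ.Leaf := inferInstanceAs (Finite {x : τ.vertex // τ.IsLeaf x})

theorem pathDist_self (x : τ.vertex) : τ.pathDist x x = 0 := by
  unfold pathDist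
  rw [← τ.path_unique SimpleGraph.Walk.nil SimpleGraph.Walk.IsPath.nil]
  simp

theorem pathDist_comm (x y : τ.vertex) : τ.pathDist x y = τ.pathDist y x := by
  unfold pathDist
  rw [← τ.path_unique (τ.path x y).reverse (τ.path_isPath x y).reverse]
  simp [List.sum_reverse]

theorem pathDist_nonneg (x y : τ.vertex) : 0 ≤ τ.pathDist x y := by
  refine List.sum_nonneg fun r hr => ?_
  obtain ⟨e, he, rfl⟩ := List.mem_map.1 hr
  exact τ.length_nonneg e ((τ.path x y).edges_subset_edgeSet he)

theorem pathDist_le {x y : τ.vertex} (w : τ.graph.Walk x y) :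
    τ.pathDist x y ≤ (w.edges.map τ.length).sum := by
  classical
  unfold pathDist
  rw [← τ.path_unique w.bypass w.bypass_isPath]
  obtain ⟨l, hl, hs⟩ : List.Subperm w.bypass.edges w.edges :=
    w.bypass_isPath.isTrail.edges_nodup.subperm w.edges_bypass_subset_edges
  rw [← (hl.map τ.length).sum_eq]
  refine (hs.map τ.length).sum_le_sum fun r hr => ?_
  obtain ⟨e, he, rfl⟩ := List.mem_map.1 hr
  exact τ.length_nonneg e (w.edges_subset_edgeSet he)

theorem pathDist_triangle (x y z : τ.vertex) :
    τ.pathDist x z ≤ τ.pathDist x y + τ.pathDist y z := by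
  refine (τ.pathDist_le ((τ.path x y).append (τ.path y z))).trans_eq ?_
  simp [pathDist, SimpleGraph.Walk.edges_append]

end MetricTree

/-- A finite metric forest: a finite metric space `B` and a finite rooted tree for each point
of `B`. -/
structure MetricForest : Type (max (u + 1) (v + 1)) where
  B : Type u
  [finite : Finite B]
  [metric : MetricSpace B]
  component : B → MetricTree.{v}

namespace MetricForest

variable (ζ : MetricForest.{u, v})

instance : Finite ζ.B := ζ.finite

instance : MetricSpace ζ.B := ζ.metric

/-- The base, as a finite pseudometric space. -/
def base : FinPMet.{u} := ⟨ζ.B⟩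

/-- The set of leaves of the forest. -/
def Leaf : Type (max u v) := Σ a : ζ.B, (ζ.component a).Leaf

instance : Finite ζ.Leaf := inferInstanceAs (Finite (Σ a : ζ.B, (ζ.component a).Leaf))

/-- The distance between two leaves of the forest. -/
noncomputable def leafDist (x y : ζ.Leaf) : ℝ :=
  open Classical in
  if h : x.1 = y.1 then (ζ.component y.1).pathDist (h ▸ x.2).1 y.2.1
  else (ζ.component x.1).pathDist x.2.1 (ζ.component x.1).root + dist x.1 y.1 +
    (ζ.component y.1).pathDist y.2.1 (ζ.component y.1).root

theorem leafDist_same {a : ζ.B} (x y : (ζ.component a).Leaf) :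
    ζ.leafDist ⟨a, x⟩ ⟨a, y⟩ = (ζ.component a).pathDist x.1 y.1 := by
  simp [leafDist]

theorem leafDist_of_ne {a b : ζ.B} (h : a ≠ b) (x : (ζ.component a).Leaf)
    (y : (ζ.component b).Leaf) :
    ζ.leafDist ⟨a, x⟩ ⟨b, y⟩ = (ζ.component a).pathDist x.1 (ζ.component a).root + dist a b +
      (ζ.component b).pathDist y.1 (ζ.component b).root := by
  simp [leafDist, h]

theorem leafDist_self (x : ζ.Leaf) : ζ.leafDist x x = 0 := by
  obtain ⟨a, x⟩ := x
  rw [leafDist_same, MetricTree.pathDist_self]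

theorem leafDist_comm (x y : ζ.Leaf) : ζ.leafDist x y = ζ.leafDist y x := by
  obtain ⟨a, x⟩ := x
  obtain ⟨b, y⟩ := y
  by_cases h : a = b
  · subst h
    rw [leafDist_same, leafDist_same, MetricTree.pathDist_comm]
  · rw [leafDist_of_ne _ h, leafDist_of_ne _ (Ne.symm h), dist_comm a b]
    ring

theorem leafDist_triangle (x y z : ζ.Leaf) :
    ζ.leafDist x z ≤ ζ.leafDist x y + ζ.leafDist y z := by
  obtain ⟨a, x⟩ := x
  obtain ⟨b, y⟩ := y
  obtain ⟨c, z⟩ := z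
  by_cases hab : a = b
  · subst hab
    by_cases hac : a = c
    · subst hac
      simp only [leafDist_same]
      exact MetricTree.pathDist_triangle _ _ _ _
    · rw [leafDist_same, leafDist_of_ne _ hac, leafDist_of_ne _ hac]
      linarith [(ζ.component a).pathDist_triangle x.1 y.1 (ζ.component a).root]
  · by_cases hbc : b = c
    · subst hbc
      rw [leafDist_same, leafDist_of_ne _ hab, leafDist_of_ne _ hab]
      have := (ζ.component b).pathDist_triangle z.1 y.1 (ζ.component b).root
      rw [(ζ.component b).pathDist_comm z.1 y.1] at this
      linarith
    · rw [leafDist_of_ne _ hab, leafDist_of_ne _ hbc]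
      have hy := (ζ.component b).pathDist_nonneg y.1 (ζ.component b).root
      by_cases hac : a = c
      · subst hac
        rw [leafDist_same]
        have := (ζ.component a).pathDist_triangle x.1 (ζ.component a).root z.1
        rw [(ζ.component a).pathDist_comm (ζ.component a).root z.1] at this
        linarith [dist_nonneg (x := a) (y := b), dist_nonneg (x := b) (y := a)]
      · rw [leafDist_of_ne _ hac]
        linarith [dist_triangle a b c]

/-- The leaf space of a finite metric forest. -/
noncomputable def leafSpace : FinPMet.{max u v} where
  carrier := ζ.Leaf
  pseudoMetric :=
    { dist := ζ.leafDist
      dist_self := ζ.leafDist_self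
      dist_comm := ζ.leafDist_comm
      dist_triangle := ζ.leafDist_triangle }

end MetricForest

end TrimCore

namespace TrimCore

/-! ### Invariance of the trim core -/

section Under

variable {X : Type u} [PseudoMetricSpace X]

/-! The proof rests on two moves that preserve the trim core. The first adds `g x + g y` to the
distance of every pair of distinct points. This adds `g` to `under` when there are at least three
points, so `bulletDist` does not change (`bulletDist_of_shift`) and the trimmings are isometric. No
sign of `g` is needed. The second identifies points at distance zero
(`trimEquivalent_metricQuotient`). It is the delicate one: a duplicate point enters the infimum
defining `under`, so a space and its quotient may have different trimmings, and only an induction on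
cardinality reconciles their cores. Together they allow replacing pendant edges by their attachment
points, even if several of these coincide (`TrimEquivalent.of_pendant`).

A forest is pruned by this rule from the outside in. In the cut at depth `n + 1`, every vertex of
depth `n + 1` hangs from its parent by a pendant edge; contracting these edges gives the cut at
depth `n`. For large `n` the cut is the leaf space, and at depth `0` it consists of the roots, a
copy of the base. -/

theorem under_nonneg (x : X) : 0 ≤ under x := by
  unfold under
  split_ifs
  · exact le_rfl
  · exact div_nonneg (Real.iInf_nonneg fun _ => dist_nonneg) zero_le_two
  · refine Real.iInf_nonneg fun p => ?_
    unfold triple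
    have := dist_triangle_left p.1.1 p.1.2 x
    linarith

theorem bulletDist_le_dist (x y : X) : bulletDist x y ≤ dist x y := by
  by_cases h : x = y
  · rw [h, bulletDist_self, dist_self]
  · rw [bulletDist_of_ne h]
    linarith [under_nonneg x, under_nonneg y]

theorem bulletDist_eq_zero_of_card_le_two [Finite X] (h : Nat.card X ≤ 2) (x y : X) :
    bulletDist x y = 0 := by
  by_cases hxy : x = y
  · rw [hxy, bulletDist_self]
  have : Nontrivial X := ⟨x, y, hxy⟩
  have h2 : Nat.card X = 2 := le_antisymm h (Finite.one_lt_card_iff_nontrivial.2 this)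
  rw [bulletDist_of_ne hxy, under_of_card_eq_two h2 (Ne.symm hxy), under_of_card_eq_two h2 hxy,
    dist_comm y x]
  ring

/-- Adding `g x + g y` to all distances between distinct points adds `g` to `under`. -/
theorem under_add_le_of_shift {Y : Type v} [PseudoMetricSpace Y] [Finite X] [Finite Y]
    (h3 : 3 ≤ Nat.card X) (e : X ≃ Y) (g : X → ℝ)
    (h : ∀ x y, x ≠ y → dist (e x) (e y) = dist x y + g x + g y) (x : X) :
    under x + g x ≤ under (e x) := by
  have hY : 3 ≤ Nat.card Y := Nat.card_congr e ▸ h3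
  obtain ⟨y, z, hy, hz, hyz, hu⟩ := exists_under_eq hY (e x)
  obtain ⟨y, rfl⟩ := e.surjective y
  obtain ⟨z, rfl⟩ := e.surjective z
  rw [ne_eq, e.apply_eq_iff_eq] at hy hz hyz
  have hle := under_le h3 hy hz hyz
  rw [hu]
  unfold triple at hle ⊢
  rw [h x y (Ne.symm hy), h x z (Ne.symm hz), h y z hyz]
  linarith

/-- In `triple x y z` the terms `g y` and `g z` cancel and `g x` remains, so `under` grows by
exactly the amount that `bulletDist` subtracts again. -/
theorem bulletDist_of_shift {Y : Type v} [PseudoMetricSpace Y] [Finite X] [Finite Y]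
    (e : X ≃ Y) (g : X → ℝ)
    (h : ∀ x y, x ≠ y → dist (e x) (e y) = dist x y + g x + g y) (x y : X) :
    bulletDist (e x) (e y) = bulletDist x y := by
  have hc := Nat.card_congr e
  rcases Nat.lt_or_ge (Nat.card X) 3 with hX | hX
  -- With at most two points `under` need not shift by `g`, but both sides vanish.
  · rw [bulletDist_eq_zero_of_card_le_two (by omega), bulletDist_eq_zero_of_card_le_two (by omega)]
  have hu : ∀ x, under (e x) = under x + g x := by
    intro x
    refine le_antisymm ?_ (under_add_le_of_shift hX e g h x)
    -- The reverse inequality is the same bound for the inverse bijection, with shift `-g`.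
    have := under_add_le_of_shift (hc ▸ hX) e.symm (fun y => -g (e.symm y)) (fun p q hpq => by
      have := h (e.symm p) (e.symm q) (e.symm.injective.ne hpq)
      simp only [Equiv.apply_symm_apply] at this
      linarith) (e x)
    simp only [Equiv.symm_apply_apply] at this
    linarith
  by_cases hxy : x = y
  · rw [hxy, bulletDist_self, bulletDist_self]
  · rw [bulletDist_of_ne hxy, bulletDist_of_ne (e.injective.ne hxy), hu, hu, h x y hxy]
    ring

end Under

/-! ### Isometries of quotients and trimmings -/

/-- The map `f` may fail to be injective: its fibres have diameter zero and collapse in the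
quotient. -/
theorem nonempty_metricQuotient_isometryEquiv {X : FinPMet.{u}} {Y : FinPMet.{v}} (f : X → Y) (hs : Function.Surjective f)
    (hf : ∀ x y, dist (f x) (f y) = dist x y) :
    Nonempty (metricQuotient X ≃ᵢ metricQuotient Y) := by
  have hi : Isometry f := Isometry.of_dist_eq hf
  let F : SeparationQuotient X → SeparationQuotient Y :=
    SeparationQuotient.lift (fun x => SeparationQuotient.mk (f x)) fun x y hxy =>
      SeparationQuotient.mk_eq_mk.2 (hxy.map hi.continuous)
  have hF : Isometry F := Isometry.of_dist_eq fun p q => by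
    obtain ⟨x, rfl⟩ := SeparationQuotient.surjective_mk p
    obtain ⟨y, rfl⟩ := SeparationQuotient.surjective_mk q
    simp only [F, SeparationQuotient.lift_mk, SeparationQuotient.dist_mk, hf]
  have hFs : Function.Surjective F := fun q => by
    obtain ⟨y, rfl⟩ := SeparationQuotient.surjective_mk q
    obtain ⟨x, rfl⟩ := hs y
    exact ⟨SeparationQuotient.mk x, rfl⟩
  exact ⟨⟨Equiv.ofBijective F ⟨hF.injective, hFs⟩, hF⟩⟩

theorem nonempty_trimming_isometryEquiv {X : FinPMet.{u}} {Y : FinPMet.{v}} (e : X ≃ Y)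
    (h : ∀ x y, bulletDist (e x) (e y) = bulletDist x y) :
    Nonempty (trimming X ≃ᵢ trimming Y) :=
  nonempty_metricQuotient_isometryEquiv (X := bullet X) (Y := bullet Y) e e.surjective h

theorem nonempty_trimming_isometryEquiv_of_isometryEquiv {X : FinPMet.{u}} {Y : FinPMet.{v}}
    (e : X ≃ᵢ Y) : Nonempty (trimming X ≃ᵢ trimming Y) :=
  nonempty_trimming_isometryEquiv e.toEquiv
    (bulletDist_of_shift e.toEquiv (fun _ => 0) fun x y _ => by simp [e.dist_eq])

theorem nonempty_iterate_trimming_isometryEquiv {X : FinPMet.{u}} {Y : FinPMet.{v}}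
    (h : Nonempty (X ≃ᵢ Y)) (n : ℕ) : Nonempty (trimming^[n] X ≃ᵢ trimming^[n] Y) := by
  induction n with
  | zero => exact h
  | succ n ih =>
    rw [Function.iterate_succ_apply', Function.iterate_succ_apply']
    exact nonempty_trimming_isometryEquiv_of_isometryEquiv ih.some

theorem nonempty_isometryEquiv_metricQuotient {X : FinPMet.{u}}
    (h : ∀ x y : X, dist x y = 0 → x = y) : Nonempty (X ≃ᵢ metricQuotient X) := by
  have hi : Isometry (SeparationQuotient.mk : X → SeparationQuotient X) :=
    Isometry.of_dist_eq SeparationQuotient.dist_mk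
  refine ⟨⟨Equiv.ofBijective _ ⟨fun x y hxy => h x y ?_, SeparationQuotient.surjective_mk⟩, hi⟩⟩
  rw [← hi.dist_eq, hxy, dist_self]

theorem IsTrimMetric.of_isometryEquiv {X : FinPMet.{u}} {Y : FinPMet.{v}} (h : IsTrimMetric X)
    (e : X ≃ᵢ Y) : IsTrimMetric Y := by
  refine ⟨fun x y hxy => e.symm.injective (h.1 _ _ ?_), fun y => ?_⟩
  · rw [e.symm.dist_eq, hxy]
  · rw [← h.2 (e.symm y), under_congr e.symm]

/-- Since `under` vanishes, `bulletDist` is `dist`, and no two points get identified. -/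
theorem IsTrimMetric.nonempty_isometryEquiv_trimming {X : FinPMet.{u}} (h : IsTrimMetric X) :
    Nonempty (X ≃ᵢ trimming X) := by
  have hb : ∀ x y : X, bulletDist x y = dist x y := by
    intro x y
    by_cases hxy : x = y
    · rw [hxy, bulletDist_self, dist_self]
    · rw [bulletDist_of_ne hxy, h.2, h.2]
      ring
  obtain ⟨e⟩ := nonempty_isometryEquiv_metricQuotient (X := bullet X)
    fun x y hxy => h.1 x y ((hb x y).symm.trans hxy)
  have i : Isometry (α := X) (β := bullet X) id := Isometry.of_dist_eq (β := bullet X) hb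
  exact ⟨IsometryEquiv.trans (β := bullet X) ⟨Equiv.refl _, i⟩ e⟩

theorem IsTrimMetric.nonempty_isometryEquiv_iterate {X : FinPMet.{u}} (h : IsTrimMetric X)
    (n : ℕ) : Nonempty (X ≃ᵢ trimming^[n] X) := by
  induction n with
  | zero => exact ⟨IsometryEquiv.refl _⟩
  | succ n ih =>
    obtain ⟨e⟩ := ih
    obtain ⟨e'⟩ := (h.of_isometryEquiv e).nonempty_isometryEquiv_trimming
    rw [Function.iterate_succ_apply']
    exact ⟨e.trans e'⟩

/-! ### Criteria for trim equivalence -/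

theorem isTrimMetric_trimCore (X : FinPMet.{u}) : IsTrimMetric (trimCore X) := by
  classical
  exact Nat.find_spec (exists_iterate_trimming_isTrimMetric X)

theorem nonempty_trimCore_isometryEquiv_iterate {X : FinPMet.{u}} {n : ℕ} (hn : height X ≤ n) :
    Nonempty (trimCore X ≃ᵢ trimming^[n] X) := by
  obtain ⟨k, rfl⟩ := Nat.exists_eq_add_of_le' hn
  rw [Function.iterate_add_apply]
  exact (isTrimMetric_trimCore X).nonempty_isometryEquiv_iterate k

/-- From the height on, all iterated trimmings are isometric to the core. Trimming both given
iterates `height X + height Y` more times passes both heights. -/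
theorem TrimEquivalent.of_iterate {X : FinPMet.{u}} {Y : FinPMet.{v}} (k l : ℕ)
    (h : Nonempty (trimming^[k] X ≃ᵢ trimming^[l] Y)) : TrimEquivalent X Y := by
  obtain ⟨e⟩ := nonempty_iterate_trimming_isometryEquiv h (height X + height Y)
  rw [← Function.iterate_add_apply, ← Function.iterate_add_apply] at e
  obtain ⟨eX⟩ := nonempty_trimCore_isometryEquiv_iterate
    (show height X ≤ height X + height Y + k by omega)
  obtain ⟨eY⟩ := nonempty_trimCore_isometryEquiv_iterate
    (show height Y ≤ height X + height Y + l by omega)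
  exact ⟨(eX.trans e).trans eY.symm⟩

theorem TrimEquivalent.symm {X : FinPMet.{u}} {Y : FinPMet.{v}} (h : TrimEquivalent X Y) :
    TrimEquivalent Y X :=
  h.map IsometryEquiv.symm

universe w

theorem TrimEquivalent.trans {X : FinPMet.{u}} {Y : FinPMet.{v}} {Z : FinPMet.{w}}
    (h : TrimEquivalent X Y) (h' : TrimEquivalent Y Z) : TrimEquivalent X Z :=
  Nonempty.map2 IsometryEquiv.trans h h'

theorem TrimEquivalent.of_isometryEquiv {X : FinPMet.{u}} {Y : FinPMet.{v}}
    (h : Nonempty (X ≃ᵢ Y)) : TrimEquivalent X Y :=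
  .of_iterate 0 0 h

theorem trimEquivalent_trimming (X : FinPMet.{u}) : TrimEquivalent X (trimming X) :=
  .of_iterate 1 0 ⟨IsometryEquiv.refl _⟩

theorem TrimEquivalent.of_shift {X : FinPMet.{u}} {Y : FinPMet.{v}} (e : X ≃ Y) (g : X → ℝ)
    (h : ∀ x y, x ≠ y → dist (e x) (e y) = dist x y + g x + g y) : TrimEquivalent X Y :=
  .of_iterate 1 1 (nonempty_trimming_isometryEquiv e (bulletDist_of_shift e g h))

/-- Choose a representative of each class and let `Z` be the set of classes with `bulletDist` of `X`
between representatives. Up to isometry, `Z` has metric quotient `trimming X`; up to a shift, `Z` is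
the metric quotient of `X`. If `X` is not already metric, `Z` has fewer points, and induction
identifies it with its own quotient. -/
theorem trimEquivalent_metricQuotient (X : FinPMet.{u}) :
    TrimEquivalent X (metricQuotient X) := by
  induction hN : Nat.card X using Nat.strong_induction_on generalizing X with
  | _ N ih =>
    by_cases hX : ∀ x y : X, dist x y = 0 → x = y
    · exact .of_isometryEquiv (nonempty_isometryEquiv_metricQuotient hX)
    let out : SeparationQuotient X → bullet X := Quotient.out
    have hmk : ∀ p, SeparationQuotient.mk (X := X) (out p) = p := fun p => Quotient.out_eq p
    let Z : FinPMet.{u} :=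
      { carrier := SeparationQuotient X
        finite := Quotient.finite _
        pseudoMetric := PseudoMetricSpace.induced out (bullet X).pseudoMetric }
    have hcard : Nat.card Z < N := by
      have hle : Nat.card (SeparationQuotient X) ≤ Nat.card X :=
        Nat.card_le_card_of_surjective _ SeparationQuotient.surjective_mk
      refine lt_of_le_of_ne (hN ▸ hle) fun he => hX fun x y hxy => ?_
      refine ((Nat.bijective_iff_surjective_and_card (SeparationQuotient.mk (X := X))).2
        ⟨SeparationQuotient.surjective_mk, hN.trans he.symm⟩).1 ?_
      exact SeparationQuotient.mk_eq_mk.2 (Metric.inseparable_iff.2 hxy)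
    -- Points at distance zero stay so after trimming, because `bulletDist` is at most `dist`.
    have hzero : ∀ x : X, dist (out (SeparationQuotient.mk x)) (x : bullet X) = 0 := by
      intro x
      have hi : Inseparable (X := X) (out (SeparationQuotient.mk x)) x :=
        (SeparationQuotient.mk_eq_mk (X := X)).1 (hmk _)
      exact le_antisymm ((bulletDist_le_dist (X := X) _ _).trans_eq
        (Metric.inseparable_iff (α := X).1 hi)) dist_nonneg
    have h1 : Nonempty (trimming X ≃ᵢ metricQuotient Z) := by
      let q : bullet X → Z := SeparationQuotient.mk (X := X)
      have hq : Function.Surjective q := SeparationQuotient.surjective_mk (X := X)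
      refine nonempty_metricQuotient_isometryEquiv (X := bullet X) (Y := Z) q hq fun x y => ?_
      change dist (out (SeparationQuotient.mk (X := X) x)) (out (SeparationQuotient.mk (X := X) y)) =
        dist x y
      have hx := hzero x
      have hy := hzero y
      have a1 := dist_triangle4 (out (SeparationQuotient.mk (X := X) x)) x y
        (out (SeparationQuotient.mk (X := X) y))
      have a2 := dist_triangle4 x (out (SeparationQuotient.mk (X := X) x))
        (out (SeparationQuotient.mk (X := X) y)) y
      rw [dist_comm y] at a1
      rw [dist_comm x (out _)] at a2
      linarith
    have h2 : TrimEquivalent Z (metricQuotient X) := by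
      -- The shift is `under` computed in `X`, not in `Z`: adding it back turns `bulletDist` between
      -- representatives into `dist`.
      refine .of_shift (Equiv.refl (SeparationQuotient X))
        (fun p => under (X := X) (out p)) fun p q hpq => ?_
      have hne : out p ≠ out q := fun e => hpq (by rw [← hmk p, e, hmk])
      change dist (α := SeparationQuotient X) p q =
        bulletDist (X := X) (out p) (out q) + under (X := X) (out p) + under (X := X) (out q)
      rw [bulletDist_of_ne (X := X) hne]
      conv_lhs => rw [← hmk p, ← hmk q, SeparationQuotient.dist_mk]
      ring
    exact (trimEquivalent_trimming X).trans
      ((TrimEquivalent.of_isometryEquiv h1).trans ((ih _ hcard Z rfl).symm.trans h2))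

theorem TrimEquivalent.of_surjective {X : FinPMet.{u}} {Y : FinPMet.{v}} (f : X → Y)
    (hs : Function.Surjective f) (hf : ∀ x y, dist (f x) (f y) = dist x y) :
    TrimEquivalent X Y :=
  (trimEquivalent_metricQuotient X).trans ((TrimEquivalent.of_isometryEquiv
    (nonempty_metricQuotient_isometryEquiv f hs hf)).trans
    (trimEquivalent_metricQuotient Y).symm)

/-- If `X` arises from `Y` by duplicating points and attaching a pendant edge of length `g x` at
each resulting point, then `X` and `Y` are trim equivalent. -/
theorem TrimEquivalent.of_pendant {X : FinPMet.{u}} {Y : FinPMet.{v}} (f : X → Y)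
    (hs : Function.Surjective f) (g : X → ℝ)
    (h : ∀ x y, x ≠ y → dist x y = dist (f x) (f y) + g x + g y) : TrimEquivalent X Y := by
  -- `X'` is `X` with the pendant edges contracted and the resulting duplicates still present; a
  -- shift by `g` leads back to `X`.
  let X' : FinPMet.{u} :=
    { carrier := X
      pseudoMetric := PseudoMetricSpace.induced f Y.pseudoMetric }
  have h1 : TrimEquivalent X' X := .of_shift (Equiv.refl X) g h
  have h2 : TrimEquivalent X' Y := .of_surjective (X := X') f hs fun _ _ => rfl
  exact h1.symm.trans h2

/-! ### Depth in rooted trees -/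

namespace MetricTree

variable (τ : MetricTree.{u})

/-- The number of edges of the path to the root. -/
noncomputable def depth (x : τ.vertex) : ℕ := (τ.path x τ.root).length

theorem depth_eq_length {x : τ.vertex} (w : τ.graph.Walk x τ.root) (hw : w.IsPath) :
    τ.depth x = w.length := by
  rw [depth, ← τ.path_unique w hw]

theorem depth_root : τ.depth τ.root = 0 :=
  τ.depth_eq_length SimpleGraph.Walk.nil SimpleGraph.Walk.IsPath.nil

theorem eq_root_of_depth_eq_zero {x : τ.vertex} (h : τ.depth x = 0) : x = τ.root :=
  SimpleGraph.Walk.eq_of_length_eq_zero h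

/-- The part of the path from `x` onwards is the path from `x` to the root, and it is strictly
shorter. -/
theorem depth_lt_of_mem_support {x y : τ.vertex} (h : x ∈ (τ.path y τ.root).support)
    (hne : x ≠ y) : τ.depth x < τ.depth y := by
  classical
  have hlen := congrArg SimpleGraph.Walk.length ((τ.path y τ.root).take_spec h)
  rw [SimpleGraph.Walk.length_append] at hlen
  rw [τ.depth_eq_length _ ((τ.path_isPath y τ.root).dropUntil h), depth, ← hlen]
  have : ((τ.path y τ.root).takeUntil x h).length ≠ 0 := fun h0 =>
    hne (SimpleGraph.Walk.eq_of_length_eq_zero h0).symm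
  omega

theorem pathDist_of_adj {x p y : τ.vertex} (h : τ.graph.Adj x p)
    (hx : x ∉ (τ.path p y).support) :
    τ.pathDist x y = τ.length s(x, p) + τ.pathDist p y := by
  unfold pathDist
  rw [← τ.path_unique (SimpleGraph.Walk.cons h (τ.path p y)) ((τ.path_isPath p y).cons hx)]
  simp

/-- The neighbor of a vertex on the path to the root. -/
noncomputable def parent (x : τ.vertex) : τ.vertex := (τ.path x τ.root).snd

theorem adj_parent {x : τ.vertex} (hx : x ≠ τ.root) : τ.graph.Adj x (τ.parent x) :=
  SimpleGraph.Walk.adj_snd fun hn => hx hn.eq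

theorem depth_eq_depth_parent_add_one {x : τ.vertex} (hx : x ≠ τ.root) :
    τ.depth x = τ.depth (τ.parent x) + 1 := by
  have hn : ¬ (τ.path x τ.root).Nil := fun hn => hx hn.eq
  have := τ.depth_eq_length _ (τ.path_isPath x τ.root).tail
  rw [parent, this, depth, SimpleGraph.Walk.length_tail_add_one hn]

theorem parent_eq_of_adj {x p : τ.vertex} (h : τ.graph.Adj x p)
    (hp : τ.depth x = τ.depth p + 1) : τ.parent x = p := by
  have hx : x ∉ (τ.path p τ.root).support := fun hx => by
    have := τ.depth_lt_of_mem_support hx h.ne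
    omega
  rw [parent, ← τ.path_unique _ ((τ.path_isPath p τ.root).cons hx (h := h))]
  simp

/-- A vertex at least as deep as `y` and different from it can only be left through its parent on
the way to `y`. -/
theorem pathDist_eq_add_pathDist_parent {x y : τ.vertex} (hr : x ≠ τ.root) (hne : x ≠ y)
    (hy : τ.depth y ≤ τ.depth x) :
    τ.pathDist x y = τ.length s(x, τ.parent x) + τ.pathDist (τ.parent x) y := by
  classical
  have h := τ.adj_parent hr
  have hp := τ.depth_eq_depth_parent_add_one hr
  refine τ.pathDist_of_adj h fun hx => ?_
  -- The path from the parent to `y` lies in this detour through the root. By depth, `x` is on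
  -- neither half of it.
  let w := (τ.path (τ.parent x) τ.root).append (τ.path y τ.root).reverse
  rw [← τ.path_unique w.bypass w.bypass_isPath] at hx
  have hx' := w.support_bypass_subset_support hx
  rw [SimpleGraph.Walk.mem_support_append_iff, SimpleGraph.Walk.support_reverse,
    List.mem_reverse] at hx'
  rcases hx' with hx' | hx'
  · have := τ.depth_lt_of_mem_support hx' h.ne
    omega
  · have := τ.depth_lt_of_mem_support hx' hne
    omega

theorem depth_of_adj {x z : τ.vertex} (h : τ.graph.Adj z x)
    (hz : z ∉ (τ.path x τ.root).support) : τ.depth z = τ.depth x + 1 :=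
  τ.depth_eq_length (SimpleGraph.Walk.cons h _) ((τ.path_isPath x τ.root).cons hz)

theorem exists_adj_root : ∃ z, τ.graph.Adj τ.root z := by
  obtain ⟨e, he⟩ := τ.edge_nonempty
  induction e with
  | _ a b =>
    have hab : τ.graph.Adj a b := he
    obtain ⟨c, hc⟩ : ∃ c, c ≠ τ.root := by
      by_cases ha : a = τ.root
      · exact ⟨b, fun hb => hab.ne (ha.trans hb.symm)⟩
      · exact ⟨a, ha⟩
    cases τ.path τ.root c with
    | nil => exact absurd rfl hc
    | cons h w => exact ⟨_, h⟩

/-- This gives surjectivity when the forest is pruned. The root is never a leaf and has a neighbor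
because the tree has an edge; any other vertex that is not a leaf has a neighbor besides its parent.
-/
theorem exists_child {x : τ.vertex} (hx : ¬ τ.IsLeaf x) :
    ∃ z, τ.graph.Adj z x ∧ τ.depth z = τ.depth x + 1 := by
  classical
  by_cases hr : x = τ.root
  · subst hr
    obtain ⟨z, hz⟩ := τ.exists_adj_root
    refine ⟨z, hz.symm, τ.depth_of_adj hz.symm ?_⟩
    rw [← τ.path_unique SimpleGraph.Walk.nil SimpleGraph.Walk.IsPath.nil]
    simpa using hz.ne'
  have hP := τ.path_isPath x τ.root
  cases hw : τ.path x τ.root with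
  | nil => exact absurd rfl hr
  | @cons _ p _ h w =>
    rw [hw] at hP
    obtain ⟨z, hz, hzp⟩ : ∃ z, τ.graph.Adj x z ∧ z ≠ p := by
      by_contra! hc
      refine hx ⟨hr, Set.ncard_eq_one.2 ⟨p, Set.ext fun z => ⟨hc z, ?_⟩⟩⟩
      rintro rfl
      exact h
    refine ⟨z, hz.symm, τ.depth_of_adj hz.symm fun hzs => ?_⟩
    rw [hw, SimpleGraph.Walk.support_cons, List.mem_cons] at hzs
    have hzw : z ∈ w.support := hzs.resolve_left hz.ne'
    have hxw := (SimpleGraph.Walk.cons_isPath_iff h w).1 hP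
    -- If `z` were on the path to the root, that path up to `z` and the single edge from `x` to `z`
    -- would both be the path from `x` to `z`. Comparing lengths forces `z = p`.
    have h1 := τ.path_unique (SimpleGraph.Walk.cons h (w.takeUntil z hzw))
      ((hxw.1.takeUntil hzw).cons fun hm => hxw.2 (w.support_takeUntil_subset_support hzw hm))
    have h2 := τ.path_unique (SimpleGraph.Walk.cons hz SimpleGraph.Walk.nil)
      (SimpleGraph.Walk.IsPath.nil.cons (by simpa using hz.ne))
    have h3 := congrArg SimpleGraph.Walk.length (h1.trans h2.symm)
    simp only [SimpleGraph.Walk.length_cons, SimpleGraph.Walk.length_nil] at h3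
    exact hzp (SimpleGraph.Walk.eq_of_length_eq_zero
      (p := w.takeUntil z hzw) (by omega)).symm

end MetricTree

/-! ### Truncating a forest by depth -/

namespace MetricForest

variable (ζ : MetricForest.{u, v})

/-- The vertices of all trees of the forest. -/
abbrev Vertex : Type (max u v) := Σ a : ζ.B, (ζ.component a).vertex

/-- The distance between two vertices of the forest. -/
noncomputable def vertexDist (x y : ζ.Vertex) : ℝ :=
  open Classical in
  if h : x.1 = y.1 then (ζ.component y.1).pathDist (h ▸ x.2) y.2
  else (ζ.component x.1).pathDist x.2 (ζ.component x.1).root + dist x.1 y.1 +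
    (ζ.component y.1).pathDist y.2 (ζ.component y.1).root

theorem vertexDist_same {a : ζ.B} (x y : (ζ.component a).vertex) :
    ζ.vertexDist ⟨a, x⟩ ⟨a, y⟩ = (ζ.component a).pathDist x y := by
  simp [vertexDist]

theorem vertexDist_of_ne {a b : ζ.B} (h : a ≠ b) (x : (ζ.component a).vertex)
    (y : (ζ.component b).vertex) :
    ζ.vertexDist ⟨a, x⟩ ⟨b, y⟩ = (ζ.component a).pathDist x (ζ.component a).root + dist a b +
      (ζ.component b).pathDist y (ζ.component b).root := by
  simp [vertexDist, h]

theorem vertexDist_self (x : ζ.Vertex) : ζ.vertexDist x x = 0 := by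
  obtain ⟨a, x⟩ := x
  rw [vertexDist_same, MetricTree.pathDist_self]

theorem vertexDist_comm (x y : ζ.Vertex) : ζ.vertexDist x y = ζ.vertexDist y x := by
  obtain ⟨a, x⟩ := x
  obtain ⟨b, y⟩ := y
  by_cases h : a = b
  · subst h
    rw [vertexDist_same, vertexDist_same, MetricTree.pathDist_comm]
  · rw [vertexDist_of_ne _ h, vertexDist_of_ne _ (Ne.symm h), dist_comm a b]
    ring

theorem vertexDist_triangle (x y z : ζ.Vertex) :
    ζ.vertexDist x z ≤ ζ.vertexDist x y + ζ.vertexDist y z := by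
  obtain ⟨a, x⟩ := x
  obtain ⟨b, y⟩ := y
  obtain ⟨c, z⟩ := z
  by_cases hab : a = b
  · subst hab
    by_cases hac : a = c
    · subst hac
      simp only [vertexDist_same]
      exact MetricTree.pathDist_triangle _ _ _ _
    · rw [vertexDist_same, vertexDist_of_ne _ hac, vertexDist_of_ne _ hac]
      linarith [(ζ.component a).pathDist_triangle x y (ζ.component a).root]
  · by_cases hbc : b = c
    · subst hbc
      rw [vertexDist_same, vertexDist_of_ne _ hab, vertexDist_of_ne _ hab]
      have := (ζ.component b).pathDist_triangle z y (ζ.component b).root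
      rw [(ζ.component b).pathDist_comm z y] at this
      linarith
    · rw [vertexDist_of_ne _ hab, vertexDist_of_ne _ hbc]
      have hy := (ζ.component b).pathDist_nonneg y (ζ.component b).root
      by_cases hac : a = c
      · subst hac
        rw [vertexDist_same]
        have := (ζ.component a).pathDist_triangle x (ζ.component a).root z
        rw [(ζ.component a).pathDist_comm (ζ.component a).root z] at this
        linarith [dist_nonneg (x := a) (y := b), dist_nonneg (x := b) (y := a)]
      · rw [vertexDist_of_ne _ hac]
        linarith [dist_triangle a b c]

/-- The depth of a vertex in its tree. -/
noncomputable def depth (x : ζ.Vertex) : ℕ := (ζ.component x.1).depth x.2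

/-- The forest cut at depth `n`: the vertices of depth `n` and the leaves of smaller depth. -/
noncomputable def level (n : ℕ) : FinPMet.{max u v} where
  carrier := {x : ζ.Vertex //
    ζ.depth x = n ∨ ζ.depth x ≤ n ∧ (ζ.component x.1).IsLeaf x.2}
  pseudoMetric :=
    { dist := fun x y => ζ.vertexDist x.1 y.1
      dist_self := fun _ => ζ.vertexDist_self _
      dist_comm := fun _ _ => ζ.vertexDist_comm _ _
      dist_triangle := fun _ _ _ => ζ.vertexDist_triangle _ _ _ }

/-- The parent of a vertex in its tree. -/
noncomputable def parent (x : ζ.Vertex) : ζ.Vertex := ⟨x.1, (ζ.component x.1).parent x.2⟩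

/-- The length of the edge from a vertex to its parent. -/
noncomputable def parentLength (x : ζ.Vertex) : ℝ :=
  (ζ.component x.1).length s(x.2, (ζ.component x.1).parent x.2)

theorem ne_root_of_depth_ne_zero {x : ζ.Vertex} (hx : ζ.depth x ≠ 0) :
    x.2 ≠ (ζ.component x.1).root := fun h =>
  hx (by rw [depth, h, MetricTree.depth_root])

theorem depth_eq_depth_parent_add_one {x : ζ.Vertex} (hx : ζ.depth x ≠ 0) :
    ζ.depth x = ζ.depth (ζ.parent x) + 1 :=
  (ζ.component x.1).depth_eq_depth_parent_add_one (ζ.ne_root_of_depth_ne_zero hx)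

theorem vertexDist_eq_add_parent {x y : ζ.Vertex} (hx : ζ.depth x ≠ 0) (hne : x ≠ y)
    (hy : ζ.depth y ≤ ζ.depth x) :
    ζ.vertexDist x y = ζ.vertexDist (ζ.parent x) y + ζ.parentLength x := by
  have hr := ζ.ne_root_of_depth_ne_zero hx
  obtain ⟨a, x⟩ := x
  obtain ⟨b, y⟩ := y
  unfold parent parentLength
  by_cases hab : a = b
  · subst hab
    rw [vertexDist_same, vertexDist_same,
      (ζ.component a).pathDist_eq_add_pathDist_parent hr (fun e => hne (congrArg (Sigma.mk a) e)) hy,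
      add_comm]
  · rw [vertexDist_of_ne _ hab, vertexDist_of_ne _ hab,
      -- For different trees only the distance from `x` to its own root matters, so the root plays
      -- the part of `y`.
      (ζ.component a).pathDist_eq_add_pathDist_parent hr hr (by simp [MetricTree.depth_root])]
    ring

/-- The map sends vertices of depth `n + 1` to their parents and fixes the leaves of smaller depth.
Siblings acquire the same image, which is why `TrimEquivalent.of_pendant` must allow duplicates. -/
theorem trimEquivalent_level_succ (n : ℕ) : TrimEquivalent (ζ.level (n + 1)) (ζ.level n) := by
  classical
  let f : ζ.level (n + 1) → ζ.level n := fun x =>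
    if hx : ζ.depth x.1 = n + 1 then
      ⟨ζ.parent x.1, Or.inl (by
        have := ζ.depth_eq_depth_parent_add_one (x := x.1) (by omega)
        omega)⟩
    else ⟨x.1, Or.inr (by
      have := x.2.resolve_left hx
      exact ⟨by omega, this.2⟩)⟩
  have fpos : ∀ x : ζ.level (n + 1), ζ.depth x.1 = n + 1 → (f x).1 = ζ.parent x.1 := fun x hx =>
    congrArg Subtype.val (dif_pos hx)
  have fneg : ∀ x : ζ.level (n + 1), ζ.depth x.1 ≠ n + 1 → (f x).1 = x.1 := fun x hx =>
    congrArg Subtype.val (dif_neg hx)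
  have hle : ∀ x : ζ.level (n + 1), ζ.depth x.1 ≤ n + 1 := fun x => by
    rcases x.2 with h | h
    · exact h.le
    · exact h.1
  refine .of_pendant f ?_ (fun x => if ζ.depth x.1 = n + 1 then ζ.parentLength x.1 else 0) ?_
  · intro p
    by_cases hl : (ζ.component p.1.1).IsLeaf p.1.2
    · have hp : ζ.depth p.1 ≤ n := by
        rcases p.2 with h | h
        · exact h.le
        · exact h.1
      exact ⟨⟨p.1, Or.inr ⟨by omega, hl⟩⟩, Subtype.ext (fneg _ (show ζ.depth p.1 ≠ n + 1 by omega))⟩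
    · have hp : ζ.depth p.1 = n := p.2.resolve_right fun h => hl h.2
      obtain ⟨z, hz, hd⟩ := (ζ.component p.1.1).exists_child hl
      have hzn : ζ.depth ⟨p.1.1, z⟩ = n + 1 := hd.trans (congrArg (· + 1) hp)
      refine ⟨⟨⟨p.1.1, z⟩, Or.inl hzn⟩, Subtype.ext ((fpos _ hzn).trans ?_)⟩
      exact Sigma.ext rfl (heq_of_eq ((ζ.component p.1.1).parent_eq_of_adj hz hd))
  · intro x y hxy
    change ζ.vertexDist x.1 y.1 = ζ.vertexDist (f x).1 (f y).1 + _ + _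
    have hne : x.1 ≠ y.1 := fun h => hxy (Subtype.ext h)
    have hx1 := hle x
    have hy1 := hle y
    by_cases hx : ζ.depth x.1 = n + 1
    · have h1 := ζ.vertexDist_eq_add_parent (x := x.1) (by omega) hne (by omega)
      by_cases hy : ζ.depth y.1 = n + 1
      · have hd := ζ.depth_eq_depth_parent_add_one (x := x.1) (by omega)
        have h2 := ζ.vertexDist_eq_add_parent (x := y.1) (y := ζ.parent x.1) (by omega)
          (fun e => by rw [← e] at hd; omega) (by omega)
        rw [fpos x hx, fpos y hy, if_pos hx, if_pos hy, h1, vertexDist_comm, h2, vertexDist_comm]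
        ring
      · rw [fpos x hx, fneg y hy, if_pos hx, if_neg hy, h1]
        ring
    · by_cases hy : ζ.depth y.1 = n + 1
      · rw [fneg x hx, fpos y hy, if_neg hx, if_pos hy, vertexDist_comm,
          ζ.vertexDist_eq_add_parent (x := y.1) (by omega) hne.symm (by omega), vertexDist_comm]
        ring
      · rw [fneg x hx, fneg y hy, if_neg hx, if_neg hy]
        ring

theorem trimEquivalent_level_zero_base : TrimEquivalent (ζ.level 0) ζ.base := by
  have hroot : ∀ x : ζ.level 0, x.1.2 = (ζ.component x.1.1).root := fun x =>
    (ζ.component x.1.1).eq_root_of_depth_eq_zero <| by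
      rcases x.2 with h | h
      · exact h
      · exact Nat.le_zero.1 h.1
  refine .of_surjective (X := ζ.level 0) (Y := ζ.base) (fun x => x.1.1)
    (fun a => ⟨⟨⟨a, (ζ.component a).root⟩, Or.inl (MetricTree.depth_root _)⟩, rfl⟩) fun x y => ?_
  change dist (α := ζ.B) x.1.1 y.1.1 = ζ.vertexDist x.1 y.1
  have hx := hroot x
  have hy := hroot y
  obtain ⟨⟨a, x⟩, _⟩ := x
  obtain ⟨⟨b, y⟩, _⟩ := y
  dsimp only at hx hy ⊢
  subst hx hy
  by_cases hab : a = b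
  · subst hab
    rw [vertexDist_same, MetricTree.pathDist_self, dist_self]
  · rw [vertexDist_of_ne _ hab, MetricTree.pathDist_self, MetricTree.pathDist_self]
    ring

theorem trimEquivalent_level_base (n : ℕ) : TrimEquivalent (ζ.level n) ζ.base := by
  induction n with
  | zero => exact ζ.trimEquivalent_level_zero_base
  | succ n ih => exact (ζ.trimEquivalent_level_succ n).trans ih

theorem exists_trimEquivalent_leafSpace_level :
    ∃ n, TrimEquivalent ζ.leafSpace (ζ.level n) := by
  obtain ⟨n, hn⟩ := (Set.finite_range ζ.depth).bddAbove
  have hd : ∀ x, ζ.depth x ≤ n := fun x => hn ⟨x, rfl⟩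
  -- The cut is taken at `n + 1`, not at the bound `n`, so that no vertex has that depth and only
  -- leaves remain.
  refine ⟨n + 1, .of_surjective (X := ζ.leafSpace) (Y := ζ.level (n + 1))
    (fun x => ⟨⟨x.1, x.2.1⟩, Or.inr ⟨(hd _).trans n.le_succ, x.2.2⟩⟩) (fun p => ?_) fun x y => ?_⟩
  · have hp : (ζ.component p.1.1).IsLeaf p.1.2 := by
      rcases p.2 with h | h
      · have := hd p.1
        omega
      · exact h.2
    exact ⟨⟨p.1.1, p.1.2, hp⟩, rfl⟩
  · change ζ.vertexDist ⟨x.1, x.2.1⟩ ⟨y.1, y.2.1⟩ = ζ.leafDist x y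
    obtain ⟨a, x⟩ := x
    obtain ⟨b, y⟩ := y
    by_cases hab : a = b
    · subst hab
      rw [vertexDist_same, leafDist_same]
    · rw [vertexDist_of_ne _ hab, leafDist_of_ne _ hab]

end MetricForest

end TrimCore

theorem theorem1p5 (ζ : TrimCore.MetricForest.{u, v}) :
    TrimCore.TrimEquivalent ζ.leafSpace ζ.base := by
  obtain ⟨n, hn⟩ := ζ.exists_trimEquivalent_leafSpace_level
  exact hn.trans (ζ.trimEquivalent_level_base n)
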